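/- An oriented multi-graph $D=(V,E,\varphi)$ consists of a set $V$ of vertices, a set $E$ of arcs and a map $\varphi:E\to V\times V$; we write $x\to y$ if $\varphi(e)=(x,y)$ for some $e\in E$. $D$ is strongly connected if for all $x,y\in V$ there is a directed path from $x$ to $y$, i.e. a sequence $x=x_1,\dots,x_n=y$ of distinct vertices with $x_i\to x_{i+1}$ for $1\le i<n$. A directed circuit of length $n\ge 1$ is a sequence $C=x_1\cdots x_n$ of distinct vertices with $x_i\to x_{i+1}$ for $1\le i<n$ and $x_n\to x_1$; $V(C)$ is its set of vertices. Two distinct vertices are adjacent if $x\to y$ or $y\to x$, and the chromatic number $\chi(D)\in\mathbb{N}\cup\{\infty\}$ is the least number of colours in a colouring of $V$ that gives different colours to any two distinct adjacent vertices (loops, if any, are disregarded). For $S\subseteq V$, $D[S]$ is the oriented multi-graph formed by $S$ and all arcs of $D$ with both ends in $S$. For a positive integer $k$, a directed circuit $C$ of $D$ is $k$-good if its length is at least $k$ and $\chi(D[V(C)])\le k$. **Lemma 3.4.** Let $D$ be a strongly connected oriented multi-graph and let $k$ be an integer with $3\le k\le\chi(D)$. Then $D$ has a $k$-good circuit. 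-/

import Mathlib

universe u v

/-- An oriented multi-graph with vertex set `V` and arc set `E`: every arc `e` is mapped to the
pair (tail, head).  Parallel arcs, opposite arcs and loops are all permitted, and neither `V` nor
`E` is required to be finite. -/
structure OrientedMultigraph (V : Type u) (E : Type v) where
  ends : E → V × V

namespace OrientedMultigraph

variable {V : Type u} {E : Type v}

/-- `x → y`: some arc has tail `x` and head `y`. -/
def Arrow (D : OrientedMultigraph V E) (x y : V) : Prop :=
  ∃ e : E, D.ends e = (x, y)

/-- A directed path `x₁ x₂ … xₙ` (`n ≥ 1`): distinct vertices with `xᵢ → xᵢ₊₁`. -/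
def IsDirectedPath (D : OrientedMultigraph V E) (p : List V) : Prop :=
  p ≠ [] ∧ p.Nodup ∧ p.IsChain D.Arrow

/-- For any two vertices `x`, `y` there is a directed path from `x` to `y` (hence, exchanging
the two, also one from `y` to `x`). -/
def StronglyConnected (D : OrientedMultigraph V E) : Prop :=
  ∀ x y : V, ∃ p : List V, D.IsDirectedPath p ∧ p.head? = some x ∧ p.getLast? = some y

/-- A directed circuit `x₁ x₂ … xₙ` (`n ≥ 1`): distinct vertices with `xᵢ → xᵢ₊₁` for `i < n`
and `xₙ → x₁`.  Its length, the number of its arcs, is `n`, the length of the list. -/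
def IsCircuit (D : OrientedMultigraph V E) (c : List V) : Prop :=
  c.Nodup ∧ c.IsChain D.Arrow ∧
    ∃ x y : V, c.head? = some x ∧ c.getLast? = some y ∧ D.Arrow y x

/-- The sub-oriented-multi-graph `D[S]` induced by a set `S` of vertices: its arcs are all the
arcs of `D` with both ends in `S`. -/
def induce (D : OrientedMultigraph V E) (S : Set V) :
    OrientedMultigraph S {e : E // (D.ends e).1 ∈ S ∧ (D.ends e).2 ∈ S} where
  ends e := (⟨(D.ends e.1).1, e.2.1⟩, ⟨(D.ends e.1).2, e.2.2⟩)

/-- Adjacency in the underlying multi-graph: two distinct vertices are adjacent when an arc joins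
them, in either direction.  (Multiplicities do not matter for colourings; loops are disregarded.) -/
def underlyingGraph (D : OrientedMultigraph V E) : SimpleGraph V :=
  SimpleGraph.fromRel D.Arrow

/-- The chromatic number `χ(D)`: the least number of colours in a colouring giving different
colours to adjacent vertices (`⊤` if no finite number of colours suffices). -/
noncomputable def chromaticNumber (D : OrientedMultigraph V E) : ℕ∞ :=
  D.underlyingGraph.chromaticNumber

/-- `c` is a `k`-good circuit of `D`: a directed circuit of length at least `k` whose vertex set
induces a sub-oriented-multi-graph of chromatic number at most `k`. -/
def IsGoodCircuit (D : OrientedMultigraph V E) (k : ℕ) (c : List V) : Prop :=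
  D.IsCircuit c ∧ k ≤ c.length ∧ (D.induce {x | x ∈ c}).chromaticNumber ≤ (k : ℕ∞)

end OrientedMultigraph

/-! Put `K = k - 1 ≥ 2`. Then `D` is not `K`-colourable, so by compactness some finite vertex set is
not, and it lies in a finite strong set `T`. Inside `T` take a largest strong `K`-colourable set `S`
and a shortest ear `p` of `S`. By minimality only the first vertex of `p` is entered from `S`, only
the last one leads to `S`, and no arc skips forward along `p`.

The engine is Bondy's theorem (`colorableOn_of_cycle_length_le`): a strong set that is not
`K`-colourable has a cycle of length at least `K + 1`. Three cases remain. (1) A backward chord of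
`p` spans at least `K`: a shortest such chord closes a good cycle (`exists_good_of_chord`). (2) `S ∪
p` is `(K + 1)`-colourable: by maximality of `S` it is not `K`-colourable, so Bondy's cycle in it is
good. (3) Otherwise the ends of `p` are adjacent, hence `p` has between 2 and `K` vertices.
Contracting `p` to one vertex gives a strong digraph that is not `K`-colourable; a long cycle there
is expanded through `p` and shortened until its vertices can be coloured (`exists_good_of_short`).

Bondy's theorem is proved by weighting arcs so that every arc lies on a closed walk of weight one
(`exists_tight_weight`), then colouring by a longest-walk potential modulo `K`. -/

namespace RelCircuit

variable {V : Type u}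

/-! ### Colourings, strong sets and cycles of a relation -/

/-- `S` has a colouring with `n` colours in which distinct related vertices differ. -/
def ColorableOn (A : V → V → Prop) (S : Set V) (n : ℕ) : Prop :=
  ∃ f : V → ℕ, (∀ x ∈ S, f x < n) ∧ ∀ x ∈ S, ∀ y ∈ S, A x y → x ≠ y → f x ≠ f y

/-- The relation `A` restricted to `S`. -/
def restrict (A : V → V → Prop) (S : Set V) (x y : V) : Prop := A x y ∧ x ∈ S ∧ y ∈ S

/-- Any two vertices of `S` are joined by a walk inside `S`. -/
def StrongOn (A : V → V → Prop) (S : Set V) : Prop :=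
  ∀ x ∈ S, ∀ y ∈ S, Relation.ReflTransGen (restrict A S) x y

/-- A nonempty duplicate-free list along `A` whose last entry is related to the first. -/
def IsCycle (A : V → V → Prop) (c : List V) : Prop :=
  c ≠ [] ∧ c.Nodup ∧ c.IsChain A ∧ ∀ x ∈ c.getLast?, ∀ y ∈ c.head?, A x y

/-! ### Weighted walks and their decomposition into cycles -/

/-- `Walk A b x y n w`: a walk from `x` to `y` with `n` arcs and total `b`-weight `w`. -/
inductive Walk (A : V → V → Prop) (b : V → V → ℕ) : V → V → ℕ → ℕ → Prop
  | nil (x : V) : Walk A b x x 0 0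
  | cons {x y z : V} {n w : ℕ} : A x y → Walk A b y z n w → Walk A b x z (n + 1) (b x y + w)

variable {A : V → V → Prop} {b : V → V → ℕ}

theorem Walk.append {x y z : V} {n w n' w' : ℕ} (h : Walk A b x y n w) (h' : Walk A b y z n' w') :
    Walk A b x z (n + n') (w + w') := by
  induction h with
  | nil x => simpa using h'
  | cons ha _ ih =>
    have := Walk.cons ha (ih h')
    rwa [← add_assoc, add_right_comm] at this

theorem Walk.of_reflTransGen {x y : V} (b : V → V → ℕ) (h : Relation.ReflTransGen A x y) :
    ∃ n w, Walk A b x y n w := by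
  induction h using Relation.ReflTransGen.head_induction_on with
  | refl => exact ⟨0, 0, .nil _⟩
  | head ha _ ih =>
    obtain ⟨n, w, h⟩ := ih
    exact ⟨_, _, .cons ha h⟩

theorem Walk.pos_of_ne {x y : V} {n w : ℕ} (h : Walk A b x y n w) (hne : x ≠ y) : 1 ≤ n := by
  cases h with
  | nil => exact absurd rfl hne
  | cons => omega

/-- A walk either has no repetition before its last vertex or contains a proper closed subwalk. -/
theorem Walk.nodup_or_split {x y : V} {n w : ℕ} (h : Walk A b x y n w) :
    (∃ l : List V, l.Nodup ∧ l.length = n ∧ (l ++ [y]).IsChain A ∧ (l ++ [y]).head? = some x ∧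
      ∀ z ∈ l, ∃ n₁ w₁ n₂ w₂, Walk A b x z n₁ w₁ ∧ Walk A b z y n₂ w₂ ∧ n₁ + n₂ = n ∧
        w₁ + w₂ = w ∧ 1 ≤ n₂) ∨
    ∃ z n₁ w₁ n₂ w₂ n₃ w₃, Walk A b x z n₁ w₁ ∧ Walk A b z z n₂ w₂ ∧ Walk A b z y n₃ w₃ ∧
      n₁ + n₂ + n₃ = n ∧ w₁ + w₂ + w₃ = w ∧ 1 ≤ n₂ ∧ 1 ≤ n₃ := by
  induction h with
  | nil x => exact .inl ⟨[], by simp⟩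
  | @cons x x' y n w ha hw ih =>
    rcases ih with ⟨l, hnd, hlen, hch, hhd, hsp⟩ | ⟨z, n₁, w₁, n₂, w₂, n₃, w₃, h₁, h₂, h₃, hn, hw', h⟩
    -- If `x` recurs, the splitting clause carried through the induction cuts out the closed walk
    -- from `x` back to `x`.
    · by_cases hx : x ∈ l
      · obtain ⟨n₁, w₁, n₂, w₂, h₁, h₂, hn, hw', hp⟩ := hsp x hx
        exact .inr ⟨x, 0, 0, _, _, _, _, .nil x, .cons ha h₁, h₂, by omega, by omega, by omega, hp⟩
      · refine .inl ⟨x :: l, by simp [hx, hnd], by simp [hlen], ?_, by simp, ?_⟩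
        · rw [List.cons_append, List.isChain_cons]
          refine ⟨fun z hz => ?_, hch⟩
          rw [hhd] at hz
          cases hz
          exact ha
        · intro z hz
          rcases List.mem_cons.1 hz with rfl | hz
          · exact ⟨0, 0, _, _, .nil _, .cons ha hw, by omega, by omega, by omega⟩
          · obtain ⟨n₁, w₁, n₂, w₂, h₁, h₂, hn, hw', hp⟩ := hsp z hz
            exact ⟨_, _, _, _, .cons ha h₁, h₂, by omega, by omega, hp⟩
    · exact .inr ⟨z, _, _, _, _, _, _, .cons ha h₁, h₂, h₃, by omega, by omega, h⟩

/-- If nonempty closed walks have positive weight and cycles have length at most `K`, then a closed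
walk has length at most `K` times its weight. -/
theorem Walk.length_le {K : ℕ} (hpos : ∀ x n w, Walk A b x x n w → 1 ≤ n → 1 ≤ w)
    (hK : ∀ c, IsCycle A c → c.length ≤ K) (n : ℕ) :
    ∀ x w, Walk A b x x n w → n ≤ K * w := by
  induction n using Nat.strong_induction_on with
  | _ n ih =>
    intro x w h
    rcases Nat.eq_zero_or_pos n with rfl | hn
    · simp
    rcases h.nodup_or_split with ⟨l, hnd, hlen, hch, hhd, -⟩ |
      ⟨z, n₁, w₁, n₂, w₂, n₃, w₃, h₁, h₂, h₃, rfl, rfl, hn₂, hn₃⟩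
    · have hl : l ≠ [] := by rintro rfl; simp at hlen; omega
      have hw := hpos x n w h hn
      rw [List.isChain_append] at hch
      have hc := hK l ⟨hl, hnd, hch.1, fun a ha c hc => by
        rw [List.head?_append_of_ne_nil _ hl] at hhd
        rw [hhd] at hc
        cases hc
        exact hch.2.2 a ha _ (by simp)⟩
      nlinarith
    -- The closed subwalk and the walk with it removed are both shorter, and their bounds add up.
    · have e₁ := ih n₂ (by omega) z w₂ h₂
      have e₂ := ih (n₁ + n₃) (by omega) x (w₁ + w₃) (h₁.append h₃)
      nlinarith

/-! ### Tight arc weights -/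

/-- Changing the weights by a potential difference. -/
theorem Walk.shift {h : V → ℕ} (hb : ∀ x y, A x y → h y ≤ b x y + h x) {x y : V} {n w : ℕ}
    (hw : Walk A b x y n w) :
    ∃ w', Walk A (fun x y => b x y + h x - h y) x y n w' ∧ w' + h y = w + h x := by
  induction hw with
  | nil x => exact ⟨0, .nil x, rfl⟩
  | @cons x y z n w ha _ ih =>
    obtain ⟨w', hw', e⟩ := ih
    refine ⟨_, .cons ha hw', ?_⟩
    have := hb x y ha
    omega

theorem Walk.unshift {h : V → ℕ} (hb : ∀ x y, A x y → h y ≤ b x y + h x) {x y : V} {n w' : ℕ}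
    (hw : Walk A (fun x y => b x y + h x - h y) x y n w') :
    ∃ w, Walk A b x y n w ∧ w' + h y = w + h x := by
  induction hw with
  | nil x => exact ⟨0, .nil x, rfl⟩
  | @cons x y z n w ha _ ih =>
    obtain ⟨w', hw', e⟩ := ih
    refine ⟨_, .cons ha hw', ?_⟩
    have := hb x y ha
    omega

open Classical in
/-- Lowering the weight of one arc by one. -/
noncomputable def lower (b : V → V → ℕ) (p q : V) (x y : V) : ℕ :=
  if x = p ∧ y = q then b x y - 1 else b x y

theorem lower_le (b : V → V → ℕ) (p q x y : V) : lower b p q x y ≤ b x y := by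
  unfold lower; split <;> omega

theorem Walk.mono {b' : V → V → ℕ} (hb : ∀ x y, b' x y ≤ b x y) {x y : V} {n w : ℕ}
    (h : Walk A b x y n w) : ∃ w' ≤ w, Walk A b' x y n w' := by
  induction h with
  | nil x => exact ⟨0, le_rfl, .nil x⟩
  | @cons x y z n w ha _ ih =>
    obtain ⟨w', hw', h⟩ := ih
    have := hb x y
    exact ⟨_, by omega, .cons ha h⟩

/-- A walk for the lowered weights either avoids the arc or is long through it. -/
theorem Walk.of_lower {p q x y : V} {n w : ℕ} (h : Walk A (lower b p q) x y n w) :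
    Walk A b x y n w ∨ ∃ n₁ w₁ n₂ w₂, Walk A b x p n₁ w₁ ∧ Walk A b q y n₂ w₂ ∧
      w₁ + (b p q - 1) + w₂ ≤ w := by
  induction h with
  | nil x => exact .inl (.nil x)
  | @cons x y z n w ha _ ih =>
    by_cases he : x = p ∧ y = q
    · obtain ⟨rfl, rfl⟩ := he
      have e : lower b x y x y = b x y - 1 := by simp [lower]
      rcases ih with h | ⟨n₁, w₁, n₂, w₂, h₁, h₂, hle⟩
      · exact .inr ⟨0, 0, _, _, .nil _, h, by omega⟩
      -- With several passes through the arc, the stretch up to the last one is dropped; this costs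
      -- nothing as weights are nonnegative.
      · exact .inr ⟨0, 0, _, _, .nil _, h₂, by omega⟩
    · have e : lower b p q x y = b x y := by simp only [lower, if_neg he]
      rw [e]
      rcases ih with h | ⟨n₁, w₁, n₂, w₂, h₁, h₂, hle⟩
      · exact .inl (.cons ha h)
      · exact .inr ⟨_, _, _, _, .cons ha h₁, h₂, by omega⟩

/-- Least weight of a walk. -/
noncomputable def dist (A : V → V → Prop) (b : V → V → ℕ) (x y : V) : ℕ :=
  sInf {w | ∃ n, Walk A b x y n w}

theorem dist_le {x y : V} {n w : ℕ} (h : Walk A b x y n w) : dist A b x y ≤ w :=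
  Nat.sInf_le ⟨n, h⟩

theorem exists_walk_dist {x y : V} (h : Relation.ReflTransGen A x y) :
    ∃ n, Walk A b x y n (dist A b x y) := by
  obtain ⟨n, w, h⟩ := Walk.of_reflTransGen b h
  exact Nat.sInf_mem (s := {w | ∃ n, Walk A b x y n w}) ⟨w, n, h⟩

open Classical in
/-- A finite strong digraph has arc weights for which nonempty closed walks have positive weight
and every arc lies on a closed walk of weight at most one. -/
theorem exists_tight_weight (S : Finset V) (hA : ∀ x y, A x y → x ∈ S ∧ y ∈ S)
    (hS : ∀ x ∈ S, ∀ y ∈ S, Relation.ReflTransGen A x y) :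
    ∃ b : V → V → ℕ, (∀ x n w, Walk A b x x n w → 1 ≤ n → 1 ≤ w) ∧
      ∀ x y, A x y → ∃ n w, Walk A b y x n w ∧ b x y + w ≤ 1 := by
  let P : (V → V → ℕ) → Prop := fun b => ∀ x n w, Walk A b x x n w → 1 ≤ n → 1 ≤ w
  let cyc : (V → V → ℕ) → V × V → ℕ := fun b e =>
    if A e.1 e.2 then b e.1 e.2 + dist A b e.2 e.1 else 0
  -- The total, over all arcs, of the least weight of a closed walk through the arc. A minimiser
  -- among admissible weights is tight.
  let μ : (V → V → ℕ) → ℕ := fun b => ∑ e ∈ S ×ˢ S, cyc b e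
  have hex : ∃ b, P b := by
    refine ⟨fun _ _ => 1, fun x n w h hn => ?_⟩
    cases h with
    | nil => omega
    | cons => omega
  obtain ⟨b, hb, hmin⟩ : ∃ b, P b ∧ ∀ b', P b' → μ b ≤ μ b' := by
    have hne : (μ '' {b | P b}).Nonempty := hex.elim fun b hb => ⟨_, b, hb, rfl⟩
    obtain ⟨b, hb, e⟩ := Nat.sInf_mem hne
    exact ⟨b, hb, fun b' hb' => e ▸ Nat.sInf_le ⟨b', hb', rfl⟩⟩
  refine ⟨b, hb, fun p q hpq => ?_⟩
  by_contra hcon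
  push Not at hcon
  -- A 0-1 potential vanishing exactly on the vertices reached from `q` at weight zero. Shifting by
  -- it keeps weights nonnegative and closed walks unchanged.
  let h : V → ℕ := fun x => if ∃ n, Walk A b q x n 0 then 0 else 1
  have hh : ∀ x y, A x y → h y ≤ b x y + h x := by
    intro x y hxy
    by_cases hx : ∃ n, Walk A b q x n 0
    · rcases Nat.eq_zero_or_pos (b x y) with h0 | h0
      · have : ∃ n, Walk A b q y n 0 := by
          obtain ⟨n, hn⟩ := hx
          have := hn.append (.cons hxy (.nil y))
          rw [h0] at this
          exact ⟨_, this⟩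
        simp [h, this]
      · have : h y ≤ 1 := by simp only [h]; split <;> omega
        omega
    · have : h y ≤ 1 := by simp only [h]; split <;> omega
      have : h x = 1 := by simp [h, hx]
      omega
  have hq : h q = 0 := by
    have : ∃ n, Walk A b q q n 0 := ⟨0, .nil q⟩
    simp [h, this]
  -- The shifted weight of the arc is positive, so the lowering below is a genuine decrease despite
  -- truncated subtraction.
  have hp : 1 ≤ b p q + h p := by
    by_cases hx : ∃ n, Walk A b q p n 0
    · obtain ⟨n, hn⟩ := hx
      have := hcon n 0 hn
      omega
    · have : h p = 1 := by simp [h, hx]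
      omega
  let b₁ : V → V → ℕ := fun x y => b x y + h x - h y
  have hb₁ : b₁ p q = b p q + h p := by simp [b₁, hq]
  let b₂ := lower b₁ p q
  have hP : P b₂ := by
    intro x n w hw hn
    rcases hw.of_lower with hw | ⟨n₁, w₁, n₂, w₂, h₁, h₂, hle⟩
    · obtain ⟨w', hw', e⟩ := Walk.unshift hh hw
      have := hb x n w' hw' hn
      omega
    -- A closed walk through the arc weighed at least 2 by `hcon`, so at least 1 survives the
    -- lowering.
    · obtain ⟨w', hw', e⟩ := Walk.unshift hh (h₂.append h₁)
      have := hcon _ _ hw'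
      omega
  have hle : ∀ x y, A x y → b₂ x y + dist A b₂ y x ≤ b₁ x y + dist A b y x + h y - h x := by
    intro x y hxy
    obtain ⟨n, hn⟩ := exists_walk_dist (b := b) (hS y (hA x y hxy).2 x (hA x y hxy).1)
    obtain ⟨w', hw', e⟩ := hn.shift hh
    obtain ⟨w'', hle, hw''⟩ := hw'.mono (lower_le b₁ p q)
    have := dist_le hw''
    have := lower_le b₁ p q x y
    change lower b₁ p q x y + dist A (lower b₁ p q) y x ≤ _
    omega
  have hlt : μ b₂ < μ b := by
    refine Finset.sum_lt_sum (fun e _ => ?_) ⟨(p, q), by simp [hA p q hpq], ?_⟩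
    · simp only [cyc]
      split_ifs with he
      · have := hle _ _ he
        have := hh _ _ he
        simp only [b₁] at *
        omega
      · rfl
    · simp only [cyc, if_pos hpq]
      obtain ⟨n, hn⟩ := exists_walk_dist (b := b) (hS q (hA p q hpq).2 p (hA p q hpq).1)
      obtain ⟨w', hw', e⟩ := hn.shift hh
      obtain ⟨w'', hle, hw''⟩ := hw'.mono (lower_le b₁ p q)
      have := dist_le hw''
      have e₂ : b₂ p q = b₁ p q - 1 := by simp [b₂, lower]
      change b₂ p q + dist A b₂ q p < _
      change dist A b₂ q p ≤ _ at this
      omega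
  exact absurd (hmin b₂ hP) (by omega)

/-! ### Bondy's theorem -/

/-- **Bondy's theorem**: a finite strong digraph whose cycles have length at most `K` is
`K`-colourable. -/
theorem colorableOn_of_cycle_length_le {K : ℕ} (hK0 : 0 < K) (S : Finset V)
    (hS : StrongOn A (S : Set V))
    (hK : ∀ c, IsCycle (restrict A S) c → c.length ≤ K) : ColorableOn A (S : Set V) K := by
  rcases S.eq_empty_or_nonempty with rfl | ⟨r, hr⟩
  · exact ⟨fun _ => 0, by simp⟩
  obtain ⟨b, hpos, htight⟩ := exists_tight_weight (A := restrict A S) S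
    (fun x y h => ⟨h.2.1, h.2.2⟩) hS
  have hlen := Walk.length_le hpos hK
  -- Each arc counts 1 and each unit of weight costs `K`. Closed walks then score at most 0 by
  -- `hlen`, so the best score `π` is finite.
  let Z : V → Set ℤ := fun x => {z | ∃ n w : ℕ, Walk (restrict A S) b r x n w ∧ z = n - K * w}
  let π : V → ℤ := fun x => sSup (Z x)
  have hbdd : ∀ x ∈ S, BddAbove (Z x) := by
    intro x hx
    obtain ⟨n₀, w₀, h₀⟩ := Walk.of_reflTransGen b (hS x hx r hr)
    refine ⟨K * w₀ - n₀, ?_⟩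
    rintro z ⟨n, w, h, rfl⟩
    have := hlen _ _ _ (h.append h₀)
    zify at this
    linarith
  have hmem : ∀ x ∈ S, π x ∈ Z x := by
    intro x hx
    obtain ⟨n₀, w₀, h₀⟩ := Walk.of_reflTransGen b (hS r hr x hx)
    exact Int.csSup_mem ⟨_, n₀, w₀, h₀, rfl⟩ (hbdd x hx)
  have hstep : ∀ x ∈ S, ∀ y ∈ S, ∀ n w : ℕ, Walk (restrict A S) b x y n w →
      π x + n - K * w ≤ π y := by
    intro x hx y hy n w h
    obtain ⟨n₀, w₀, h₀, e⟩ := hmem x hx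
    refine le_csSup (hbdd y hy) ⟨_, _, h₀.append h, ?_⟩
    rw [e]
    push_cast
    ring
  refine ⟨fun x => (π x % K).toNat, fun x _ => ?_, fun x hx y hy hxy hne => ?_⟩
  · have h₁ := Int.emod_lt_of_pos (π x) (by exact_mod_cast hK0 : (0 : ℤ) < K)
    have h₂ := Int.emod_nonneg (π x) (by omega : (K : ℤ) ≠ 0)
    dsimp only
    omega
  · intro heq
    have h₂ := Int.emod_nonneg (π x) (by omega : (K : ℤ) ≠ 0)
    have h₃ := Int.emod_nonneg (π y) (by omega : (K : ℤ) ≠ 0)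
    have heq' : π x % K = π y % K := by
      dsimp only at heq
      omega
    have hd : (K : ℤ) ∣ π x - π y := Int.ModEq.dvd (Eq.symm heq')
    obtain ⟨n, w, hw, hle⟩ := htight x y ⟨hxy, hx, hy⟩
    have hn := hw.pos_of_ne (Ne.symm hne)
    have e₁ := hstep x hx y hy _ _ (.cons ⟨hxy, hx, hy⟩ (.nil y))
    have e₂ := hstep y hy x hx _ _ hw
    have hz : π x - π y ≠ 0 ∧ |π x - π y| < K := by
      rw [abs_lt]
      -- An arc and its return walk bound `π y - π x` from both sides. The weightless case is
      -- contradictory; in the others the difference lies strictly between 0 and `K` in absolute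
      -- value.
      rcases (by omega : (b x y = 0 ∧ w = 0) ∨ (b x y = 0 ∧ w = 1) ∨ (b x y = 1 ∧ w = 0)) with
        ⟨h0, h1⟩ | ⟨h0, h1⟩ | ⟨h0, h1⟩ <;> rw [h0] at e₁ <;> rw [h1] at e₂ <;> push_cast at e₁ e₂ <;>
        refine ⟨?_, ?_, ?_⟩ <;> omega
    exact hz.1 (Int.eq_zero_of_abs_lt_dvd hd hz.2)

/-! ### Manipulating colourings, strong sets and cycles -/

theorem ColorableOn.mono {S T : Set V} {n : ℕ} (h : ColorableOn A T n) (hST : S ⊆ T) :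
    ColorableOn A S n := by
  obtain ⟨f, hf, hc⟩ := h
  exact ⟨f, fun x hx => hf x (hST hx), fun x hx y hy => hc x (hST hx) y (hST hy)⟩

theorem ColorableOn.le {S : Set V} {m n : ℕ} (h : ColorableOn A S m) (hmn : m ≤ n) :
    ColorableOn A S n := by
  obtain ⟨f, hf, hc⟩ := h
  exact ⟨f, fun x hx => (hf x hx).trans_le hmn, hc⟩

theorem restrict_mono {S T : Set V} (hST : S ⊆ T) (x y : V) (h : restrict A S x y) :
    restrict A T x y := ⟨h.1, hST h.2.1, hST h.2.2⟩

/-- A set is strong when all its vertices have walks from and to a well-connected subset. -/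
theorem strongOn_of_subset {S U : Set V}
    (hS : ∀ x ∈ S, ∀ y ∈ S, Relation.ReflTransGen (restrict A U) x y)
    (hU : ∀ x ∈ U, (∃ s ∈ S, Relation.ReflTransGen (restrict A U) s x) ∧
      ∃ s ∈ S, Relation.ReflTransGen (restrict A U) x s) : StrongOn A U := by
  intro x hx y hy
  obtain ⟨s, hs, h⟩ := (hU x hx).2
  obtain ⟨t, ht, h'⟩ := (hU y hy).1
  exact (h.trans (hS s hs t ht)).trans h'

theorem IsCycle.exists_rel {c : List V} (h : IsCycle A c) {x : V} (hx : x ∈ c) :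
    ∃ y, A x y := by
  obtain ⟨l₁, l₂, rfl⟩ := List.append_of_mem hx
  cases l₂ with
  | nil =>
    obtain ⟨y, hy⟩ : ∃ y, y ∈ (l₁ ++ [x]).head? := by
      cases l₁ <;> simp
    exact ⟨y, h.2.2.2 x (by simp) y hy⟩
  | cons y l =>
    have := (List.isChain_append.1 h.2.2.1).2.1
    rw [List.isChain_cons_cons] at this
    exact ⟨y, this.1⟩

theorem IsCycle.imp {B : V → V → Prop} {c : List V} (h : IsCycle A c) (hAB : ∀ x y, A x y → B x y) :
    IsCycle B c :=
  ⟨h.1, h.2.1, h.2.2.1.imp hAB, fun x hx y hy => hAB _ _ (h.2.2.2 x hx y hy)⟩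

theorem IsCycle.rotate {c : List V} (h : IsCycle A c) {x : V} (hx : x ∈ c) :
    ∃ l, IsCycle A (x :: l) ∧ (x :: l).Perm c := by
  obtain ⟨l₁, l₂, rfl⟩ := List.append_of_mem hx
  have hp : (x :: l₂ ++ l₁).Perm (l₁ ++ x :: l₂) := List.perm_append_comm
  refine ⟨l₂ ++ l₁, ⟨by simp, hp.nodup_iff.2 h.2.1, ?_, ?_⟩, hp⟩
  · have h₁ := List.isChain_append.1 h.2.2.1
    rw [← List.cons_append]
    refine List.isChain_append.2 ⟨h₁.2.1, h₁.1, fun a ha b hb => h.2.2.2 a ?_ b ?_⟩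
    · rw [List.getLast?_append_of_ne_nil _ (by simp)]
      exact ha
    · cases l₁ with
      | nil => simp at hb
      | cons => simpa using hb
  · intro a ha b hb
    obtain rfl : x = b := by simpa using hb
    rcases List.eq_nil_or_concat l₁ with rfl | ⟨l, z, rfl⟩
    · exact h.2.2.2 a (by simpa using ha) x (by simp)
    · obtain rfl : z = a := by
        rw [← List.cons_append, List.getLast?_append_of_ne_nil _ (by simp)] at ha
        simpa using ha
      exact (List.isChain_append.1 h.2.2.1).2.2 z (by simp) x (by simp)

/-- A strong finite set that is not `K`-colourable contains a cycle of length more than `K`. -/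
theorem exists_long_cycle {K : ℕ} (hK : 0 < K) (S : Finset V) (hS : StrongOn A (S : Set V))
    (hc : ¬ ColorableOn A (S : Set V) K) :
    ∃ c, IsCycle A c ∧ (∀ x ∈ c, x ∈ S) ∧ K + 1 ≤ c.length := by
  by_contra hcon
  push Not at hcon
  refine hc (colorableOn_of_cycle_length_le hK S hS fun c h => ?_)
  have := hcon c (h.imp fun _ _ h => h.1) fun x hx => by
    obtain ⟨y, hy⟩ := h.exists_rel hx
    exact hy.2.1
  omega

/-! ### Ears and shortest ears -/

/-- `p` leads from `S` to `S` through vertices of `T` outside `S`. -/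
def IsEar (A : V → V → Prop) (S T : Set V) (p : List V) : Prop :=
  p ≠ [] ∧ (∀ x ∈ p, x ∈ T ∧ x ∉ S) ∧ p.IsChain A ∧ (∃ a ∈ S, ∀ x ∈ p.head?, A a x) ∧
    ∃ b ∈ S, ∀ x ∈ p.getLast?, A x b

/-- An ear without shortcuts. -/
structure IsInducedEar (A : V → V → Prop) (S : Set V) (p : List V) : Prop where
  nodup : p.Nodup
  ne_nil : p ≠ []
  notMem : ∀ x ∈ p, x ∉ S
  chain : p.IsChain A
  exists_entry : ∃ a ∈ S, ∀ x ∈ p.head?, A a x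
  exists_exit : ∃ b ∈ S, ∀ x ∈ p.getLast?, A x b
  forward : ∀ i j (hi : i < p.length) (hj : j < p.length), A p[i] p[j] → j ≤ i + 1
  entry : ∀ s ∈ S, ∀ i (hi : i < p.length), A s p[i] → i = 0
  exit : ∀ s ∈ S, ∀ i (hi : i < p.length), A p[i] s → i + 1 = p.length

/-- Cutting out positions `i` to `j - 1`. When `i = 0` nothing precedes the cut, so `p[j]` must be
entered from `S` directly. -/
theorem IsEar.shortcut {S T : Set V} {p : List V} (h : IsEar A S T p) {i j : ℕ}
    (hj : j < p.length) (hlast : ∀ x ∈ (p.take i).getLast?, A x p[j])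
    (h0 : i = 0 → ∃ a ∈ S, A a p[j]) : IsEar A S T (p.take i ++ p.drop j) := by
  obtain ⟨hne, hmem, hch, hin, b, hb, hout⟩ := h
  have hd : p.drop j = p[j] :: p.drop (j + 1) := List.drop_eq_getElem_cons hj
  have hdne : p.drop j ≠ [] := hd ▸ List.cons_ne_nil _ _
  refine ⟨by simp [hdne], ?_, ?_, ?_, b, hb, ?_⟩
  · intro x hx
    rcases List.mem_append.1 hx with hx | hx
    · exact hmem x (List.mem_of_mem_take hx)
    · exact hmem x (List.mem_of_mem_drop hx)
  · refine List.isChain_append.2 ⟨hch.take i, hch.drop j, fun x hx y hy => ?_⟩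
    rw [hd] at hy
    cases hy
    exact hlast x hx
  · rcases Nat.eq_zero_or_pos i with rfl | hi
    · obtain ⟨a, ha, h⟩ := h0 rfl
      refine ⟨a, ha, fun x hx => ?_⟩
      rw [hd] at hx
      cases hx
      exact h
    · obtain ⟨a, ha, h⟩ := hin
      refine ⟨a, ha, fun x hx => h x ?_⟩
      cases p with
      | nil => exact absurd rfl hne
      | cons y l =>
        obtain ⟨i, rfl⟩ := Nat.exists_eq_succ_of_ne_zero hi.ne'
        simpa using hx
  · intro x hx
    refine hout x ?_
    rw [List.getLast?_append_of_ne_nil _ hdne] at hx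
    rwa [List.getLast?_drop, if_neg (by omega)] at hx

theorem getLast?_take_succ {p : List V} {i : ℕ} (hi : i < p.length) :
    (p.take (i + 1)).getLast? = some p[i] := by
  rw [List.take_succ_eq_append_getElem hi, List.getLast?_append_of_ne_nil _ (by simp)]
  simp

/-- A repeated vertex, a forward skip, a late entry or an early exit would each produce a shorter
ear. -/
theorem IsEar.isInducedEar {S T : Set V} {p : List V} (h : IsEar A S T p)
    (hmin : ∀ q, IsEar A S T q → p.length ≤ q.length) : IsInducedEar A S p where
  ne_nil := h.1
  notMem x hx := (h.2.1 x hx).2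
  chain := h.2.2.1
  exists_entry := h.2.2.2.1
  exists_exit := h.2.2.2.2
  nodup := by
    refine List.nodup_iff_pairwise_ne.2 (List.pairwise_iff_getElem.2 fun i j hi hj hij heq => ?_)
    have hear : IsEar A S T (p.take i ++ p.drop j) := by
      refine h.shortcut hj (fun x hx => ?_) fun h0 => ?_
      · rcases Nat.eq_zero_or_pos i with rfl | h0
        · simp at hx
        · obtain ⟨i, rfl⟩ := Nat.exists_eq_succ_of_ne_zero h0.ne'
          rw [getLast?_take_succ (by omega)] at hx
          cases hx
          rw [← heq]
          exact List.isChain_iff_getElem.1 h.2.2.1 i hi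
      · subst h0
        obtain ⟨a, ha, h⟩ := h.2.2.2.1
        refine ⟨a, ha, h _ ?_⟩
        rw [← heq]
        simp [List.head?_eq_getElem?]
    have := hmin _ hear
    simp only [List.length_append, List.length_take, List.length_drop] at this
    omega
  forward i j hi hj hA := by
    by_contra hlt
    have := hmin _ (h.shortcut (i := i + 1) hj (fun x hx => by
      rw [getLast?_take_succ hi] at hx
      cases hx
      exact hA) (by omega))
    simp only [List.length_append, List.length_take, List.length_drop] at this
    omega
  entry s hs i hi hA := by
    have := hmin _ (h.shortcut (i := 0) hi (by simp) fun _ => ⟨s, hs, hA⟩)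
    simp only [List.length_append, List.length_take, List.length_drop] at this
    omega
  exit s hs i hi hA := by
    have := hmin (p.take (i + 1)) ⟨by simp [h.1], fun x hx => h.2.1 x (List.mem_of_mem_take hx),
      h.2.2.1.take _, by
        obtain ⟨a, ha, h'⟩ := h.2.2.2.1
        refine ⟨a, ha, fun x hx => h' x ?_⟩
        rwa [List.head?_take, if_neg (by omega)] at hx,
      s, hs, fun x hx => by
        rw [getLast?_take_succ hi] at hx
        cases hx
        exact hA⟩
    simp only [List.length_take] at this
    omega

/-- A walk leaving `S` has a last departure from `S`. -/
theorem exists_last_departure {S T : Set V} {s x : V}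
    (h : Relation.ReflTransGen (restrict A T) s x) (hs : s ∈ S) (hx : x ∉ S) :
    ∃ a ∈ S, ∃ y, A a y ∧ y ∈ T ∧ y ∉ S ∧ Relation.ReflTransGen (restrict A (T \ S)) y x := by
  induction h with
  | refl => exact absurd hs hx
  | @tail y z _ hyz ih =>
    by_cases hy : y ∈ S
    · exact ⟨y, hy, z, hyz.1, hyz.2.2, hx, .refl⟩
    · obtain ⟨a, ha, w, haw, hwT, hwS, hwy⟩ := ih hy
      exact ⟨a, ha, w, haw, hwT, hwS, hwy.tail ⟨hyz.1, ⟨hyz.2.1, hy⟩, hyz.2.2, hx⟩⟩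

/-- A walk entering `S` has a first arrival in `S`. -/
theorem exists_first_arrival {S T : Set V} {s x : V}
    (h : Relation.ReflTransGen (restrict A T) x s) (hs : s ∈ S) (hx : x ∉ S) :
    ∃ b ∈ S, ∃ y, A y b ∧ Relation.ReflTransGen (restrict A (T \ S)) x y := by
  induction h using Relation.ReflTransGen.head_induction_on with
  | refl => exact absurd hs hx
  | @head y z hyz _ ih =>
    by_cases hz : z ∈ S
    · exact ⟨z, hz, y, hyz.1, .refl⟩
    · obtain ⟨b, hb, w, hwb, hzw⟩ := ih hz
      exact ⟨b, hb, w, hwb, hzw.head ⟨hyz.1, ⟨hyz.2.1, hx⟩, hyz.2.2, hz⟩⟩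

theorem exists_isEar {S T : Set V} (hT : StrongOn A T) (hST : S ⊂ T) (hS : S.Nonempty) :
    ∃ p, IsEar A S T p := by
  obtain ⟨s, hs⟩ := hS
  obtain ⟨x, hxT, hxS⟩ := Set.exists_of_ssubset hST
  obtain ⟨a, ha, y, hay, hyT, hyS, hyx⟩ :=
    exists_last_departure (hT s (hST.1 hs) x hxT) hs hxS
  obtain ⟨b, hb, z, hzb, hxz⟩ := exists_first_arrival (hT x hxT s (hST.1 hs)) hs hxS
  obtain ⟨l, hch, hl⟩ := List.exists_isChain_cons_of_relationReflTransGen (hyx.trans hxz)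
  refine ⟨y :: l, by simp, ?_, hch.imp fun _ _ h => h.1, ⟨a, ha, by simpa using hay⟩, b, hb, ?_⟩
  · intro w hw
    rcases List.mem_cons.1 hw with rfl | hw
    · exact ⟨hyT, hyS⟩
    · obtain ⟨i, hi, rfl⟩ := List.getElem_of_mem hw
      exact (List.isChain_iff_getElem.1 hch i (by simpa using hi)).2.2
  · intro w hw
    rw [List.getLast?_eq_some_getLast (by simp), hl] at hw
    cases hw
    exact hzb

theorem exists_isInducedEar {S T : Set V} (hT : StrongOn A T) (hST : S ⊂ T) (hS : S.Nonempty) :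
    ∃ p, IsInducedEar A S p ∧ ∀ x ∈ p, x ∈ T := by
  have hne : (List.length '' {p | IsEar A S T p}).Nonempty :=
    (exists_isEar hT hST hS).elim fun p hp => ⟨_, p, hp, rfl⟩
  obtain ⟨p, hp, e⟩ := Nat.sInf_mem hne
  exact ⟨p, IsEar.isInducedEar hp fun q hq => e ▸ Nat.sInf_le ⟨q, hq, rfl⟩,
    fun x hx => (hp.2.1 x hx).1⟩

open Classical in
-- Colouring ears and building good cycles
/-- Recolour the entries of a duplicate-free list according to their positions. -/
theorem exists_recolor {p : List V} (hp : p.Nodup) (φ : ℕ → ℕ) (f : V → ℕ) :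
    ∃ g : V → ℕ, (∀ i (hi : i < p.length), g p[i] = φ i) ∧ ∀ x, x ∉ p → g x = f x := by
  refine ⟨fun x => if x ∈ p then φ (p.idxOf x) else f x, fun i hi => ?_, fun x hx => if_neg hx⟩
  simp [hp.idxOf_getElem]

theorem mod_ne_mod {K a b : ℕ} (hne : a ≠ b) (h₁ : a < b + K) (h₂ : b < a + K) :
    a % K ≠ b % K := by
  intro h
  rcases lt_or_gt_of_ne hne with hlt | hlt
  · have := Nat.le_of_dvd (by omega) ((Nat.modEq_iff_dvd' hlt.le).1 h)
    omega
  · have := Nat.le_of_dvd (by omega) ((Nat.modEq_iff_dvd' hlt.le).1 h.symm)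
    omega

theorem IsInducedEar.strongOn {S : Set V} {p : List V} (h : IsInducedEar A S p)
    (hS : StrongOn A S) : StrongOn A (S ∪ {x | x ∈ p}) := by
  have hsub : S ⊆ S ∪ {x | x ∈ p} := Set.subset_union_left
  have hpos : 0 < p.length := List.length_pos_of_ne_nil h.ne_nil
  refine strongOn_of_subset (S := S)
    (fun x hx y hy => Relation.ReflTransGen.mono (restrict_mono hsub) _ _ (hS x hx y hy)) fun x hx => ?_
  rcases hx with hx | hx
  · exact ⟨⟨x, hx, .refl⟩, x, hx, .refl⟩
  obtain ⟨a, ha, hin⟩ := h.exists_entry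
  obtain ⟨b, hb, hout⟩ := h.exists_exit
  obtain ⟨i, hi, rfl⟩ := List.getElem_of_mem hx
  have harc : ∀ j (hj : j + 1 < p.length), restrict A (S ∪ {x | x ∈ p}) p[j] p[j + 1] := fun j hj =>
    ⟨List.isChain_iff_getElem.1 h.chain j hj, .inr (List.getElem_mem _), .inr (List.getElem_mem _)⟩
  constructor
  · refine ⟨a, ha, ?_⟩
    clear hx
    induction i with
    | zero =>
      exact .single ⟨hin _ (by simp [List.head?_eq_getElem?]), .inl ha, .inr (List.getElem_mem _)⟩
    | succ i ih => exact .tail (ih (by omega) harc) (harc i hi)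
  · refine ⟨b, hb, ?_⟩
    clear hx
    induction hn : p.length - 1 - i generalizing i with
    | zero =>
      refine .single ⟨hout _ ?_, .inr (List.getElem_mem _), .inl hb⟩
      obtain rfl : i = p.length - 1 := by omega
      simp [List.getLast?_eq_getElem?]
    | succ n ih => exact .head (harc i (by omega)) (ih (i + 1) (by omega) harc (by omega))

/-- A long backward chord of an induced ear yields a good cycle. -/
theorem IsInducedEar.exists_good_of_chord {S : Set V} {p : List V} (h : IsInducedEar A S p) {K : ℕ}
    (hK : 2 ≤ K)
    (hch : ∃ i j, ∃ (hi : i < p.length) (hj : j < p.length), A p[j] p[i] ∧ i + K ≤ j) :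
    ∃ c, IsCycle A c ∧ K + 1 ≤ c.length ∧ ColorableOn A {x | x ∈ c} (K + 1) := by
  classical
  -- Chords are indexed by their span `d`, so that `Nat.find` picks a shortest one.
  have hch' : ∃ d, ∃ i, ∃ (hi : i < p.length) (hj : i + d < p.length), A p[i + d] p[i] ∧ K ≤ d := by
    obtain ⟨i, j, hi, hj, hA, hle⟩ := hch
    obtain ⟨d, rfl⟩ := Nat.exists_eq_add_of_le (show i ≤ j by omega)
    exact ⟨d, i, hi, hj, hA, by omega⟩
  obtain ⟨i, hi, hj, hA, hle⟩ := Nat.find_spec hch'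
  have hmin := fun m hm => Nat.find_min hch' (m := m) hm
  generalize Nat.find hch' = d at hj hA hle hmin
  have hlen : ((p.drop i).take (d + 1)).length = d + 1 := by simp; omega
  -- The last vertex gets the extra colour `K`. Any other chord avoiding it spans less than `d`,
  -- hence less than `K` by minimality, so residues separate its ends.
  obtain ⟨g, hg, -⟩ := exists_recolor h.nodup (fun t => if t = i + d then K else t % K) fun _ => 0
  have hmem : ∀ x ∈ (p.drop i).take (d + 1), ∃ t, ∃ (ht : t < p.length), x = p[t] ∧ i ≤ t ∧
      t ≤ i + d := by
    intro x hx
    obtain ⟨t, ht, rfl⟩ := List.getElem_of_mem hx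
    rw [hlen] at ht
    exact ⟨i + t, by omega, by simp, by omega, by omega⟩
  refine ⟨(p.drop i).take (d + 1), ⟨?_, ?_, ?_, ?_⟩, by omega, g, ?_, ?_⟩
  · exact List.ne_nil_of_length_pos (by omega)
  · exact (h.nodup.sublist (List.drop_sublist _ _)).sublist (List.take_sublist _ _)
  · exact (h.chain.drop _).take _
  · intro x hx y hy
    rw [getLast?_take_succ (by simp; omega)] at hx
    rw [List.head?_eq_getElem?, List.getElem?_eq_getElem (by omega)] at hy
    cases hx
    cases hy
    simpa using hA
  · intro x hx
    obtain ⟨t, ht, rfl, -, -⟩ := hmem x hx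
    have := Nat.mod_lt t (show 0 < K by omega)
    rw [hg]
    split <;> omega
  · intro x hx y hy hxy hne
    obtain ⟨a, ha, rfl, ha₁, ha₂⟩ := hmem x hx
    obtain ⟨b, hb, rfl, hb₁, hb₂⟩ := hmem y hy
    have hab : a ≠ b := by rintro rfl; exact hne rfl
    have hfw := h.forward a b ha hb hxy
    rw [hg, hg]
    have h₁ := Nat.mod_lt a (show 0 < K by omega)
    have h₂ := Nat.mod_lt b (show 0 < K by omega)
    split_ifs with ea eb eb
    · omega
    · omega
    · omega
    · refine mod_ne_mod hab ?_ (by omega)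
      by_contra hlong
      obtain ⟨e, rfl⟩ := Nat.exists_eq_add_of_le (show b ≤ a by omega)
      exact hmin e (by omega) ⟨b, hb, ha, hxy, by omega⟩

/-- An induced ear with short chords and nonadjacent ends needs one extra colour. -/
theorem IsInducedEar.colorableOn_of_not_adj {S : Set V} {p : List V} (h : IsInducedEar A S p)
    {K : ℕ} (hK : 2 ≤ K) (hS : ColorableOn A S K)
    (hch : ∀ i j (hi : i < p.length) (hj : j < p.length), A p[j] p[i] → j < i + K)
    (hna : ∀ i (hi : i < p.length) (h0 : 0 < p.length), 0 < i → i + 1 = p.length →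
      ¬ A p[0] p[i] ∧ ¬ A p[i] p[0]) :
    ColorableOn A (S ∪ {x | x ∈ p}) (K + 1) := by
  obtain ⟨f, hf, hc⟩ := hS
  -- Only the ends of the ear touch `S`. They share the extra colour `K`, which is allowed because
  -- they are not adjacent.
  obtain ⟨g, hg, hgS⟩ :=
    exists_recolor h.nodup (fun t => if t = 0 ∨ t + 1 = p.length then K else t % K) f
  have hgS' : ∀ x ∈ S, g x = f x := fun x hx => hgS x fun hxp => h.notMem x hxp hx
  refine ⟨g, ?_, ?_⟩
  · rintro x (hx | hx)
    · rw [hgS' x hx]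
      have := hf x hx
      omega
    · obtain ⟨t, ht, rfl⟩ := List.getElem_of_mem hx
      have := Nat.mod_lt t (show 0 < K by omega)
      rw [hg]
      split <;> omega
  · rintro x (hx | hx) y (hy | hy) hxy hne
    · rw [hgS' x hx, hgS' y hy]
      exact hc x hx y hy hxy hne
    · obtain ⟨t, ht, rfl⟩ := List.getElem_of_mem hy
      have := h.entry x hx t ht hxy
      have := hf x hx
      rw [hgS' x hx, hg]
      rw [if_pos (by omega)]
      omega
    · obtain ⟨t, ht, rfl⟩ := List.getElem_of_mem hx
      have := h.exit y hy t ht hxy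
      have := hf y hy
      rw [hgS' y hy, hg]
      rw [if_pos (by omega)]
      omega
    · obtain ⟨a, ha, rfl⟩ := List.getElem_of_mem hx
      obtain ⟨b, hb, rfl⟩ := List.getElem_of_mem hy
      have hab : a ≠ b := by rintro rfl; exact hne rfl
      have hfw := h.forward a b ha hb hxy
      have hbw := hch b a hb ha hxy
      have h₁ := Nat.mod_lt a (show 0 < K by omega)
      have h₂ := Nat.mod_lt b (show 0 < K by omega)
      rw [hg, hg]
      split_ifs with ea eb eb
      · exfalso
        rcases Nat.eq_zero_or_pos a with rfl | h0
        · exact (hna b hb ha (by omega) (by omega)).1 hxy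
        · obtain rfl : b = 0 := by omega
          exact (hna a ha hb (by omega) (by omega)).2 hxy
      · omega
      · omega
      · exact mod_ne_mod hab (by omega) (by omega)

/-- A short induced ear needs one extra colour if its first vertex has a free colour. -/
theorem IsInducedEar.colorableOn_of_free {S S' : Set V} {p : List V} (h : IsInducedEar A S p)
    {K : ℕ} (hS' : S' ⊆ S) (hlen₂ : 2 ≤ p.length) (hlen : p.length ≤ K) {f : V → ℕ}
    (hf : ∀ x ∈ S', f x < K) (hc : ∀ x ∈ S', ∀ y ∈ S', A x y → x ≠ y → f x ≠ f y) {c : ℕ}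
    (hcK : c < K) (hfree : ∀ x ∈ S', A x (p[0]'(by omega)) → f x ≠ c) :
    ColorableOn A (S' ∪ {x | x ∈ p}) (K + 1) := by
  -- The first vertex gets the free colour `c`, the following ones distinct successors modulo `K`,
  -- and the last, the only one with arcs into `S`, the extra colour `K`.
  obtain ⟨g, hg, hgS⟩ :=
    exists_recolor h.nodup (fun t => if t + 1 = p.length then K else (c + t) % K) f
  have hgS' : ∀ x ∈ S', g x = f x := fun x hx => hgS x fun hxp => h.notMem x hxp (hS' hx)
  refine ⟨g, ?_, ?_⟩
  · rintro x (hx | hx)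
    · rw [hgS' x hx]
      have := hf x hx
      omega
    · obtain ⟨t, ht, rfl⟩ := List.getElem_of_mem hx
      have := Nat.mod_lt (c + t) (show 0 < K by omega)
      rw [hg]
      split <;> omega
  · rintro x (hx | hx) y (hy | hy) hxy hne
    · rw [hgS' x hx, hgS' y hy]
      exact hc x hx y hy hxy hne
    · obtain ⟨t, ht, rfl⟩ := List.getElem_of_mem hy
      obtain rfl := h.entry x (hS' hx) t ht hxy
      rw [hgS' x hx, hg]
      rw [if_neg (by omega), add_zero, Nat.mod_eq_of_lt hcK]
      exact hfree x hx hxy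
    · obtain ⟨t, ht, rfl⟩ := List.getElem_of_mem hx
      have := h.exit y (hS' hy) t ht hxy
      have := hf y hy
      rw [hgS' y hy, hg]
      rw [if_pos (by omega)]
      omega
    · obtain ⟨a, ha, rfl⟩ := List.getElem_of_mem hx
      obtain ⟨b, hb, rfl⟩ := List.getElem_of_mem hy
      have hab : a ≠ b := by rintro rfl; exact hne rfl
      have h₁ := Nat.mod_lt (c + a) (show 0 < K by omega)
      have h₂ := Nat.mod_lt (c + b) (show 0 < K by omega)
      rw [hg, hg]
      split_ifs with ea eb eb
      · omega
      · omega
      · omega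
      · exact mod_ne_mod (by omega) (by omega) (by omega)

/-- If the last vertex of a short induced ear leads to a path in `S` whose last vertex leads back to
the ear, then truncating the path gives a good cycle. -/
theorem IsInducedEar.exists_good_of_path {S : Set V} {p : List V} (h : IsInducedEar A S p)
    {K : ℕ} (hK : 2 ≤ K) (hS : ColorableOn A S K) (hlen₂ : 2 ≤ p.length) (hlen : p.length ≤ K)
    {q : List V} (hq : q.Nodup) (hqS : ∀ x ∈ q, x ∈ S) (hqch : q.IsChain A) (hqlen : K ≤ q.length)
    (hfirst : A (p[p.length - 1]'(by omega)) (q[0]'(by omega)))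
    (hlast : A (q[q.length - 1]'(by omega)) (p[0]'(by omega))) :
    ∃ c, IsCycle A c ∧ K + 1 ≤ c.length ∧ ColorableOn A {x | x ∈ c} (K + 1) := by
  classical
  obtain ⟨f, hf, hc⟩ := hS
  -- Stopping at the first such `j` leaves at least `K - 1` path vertices, and the ear adds at least
  -- two.
  have hex : ∃ j, K - 2 ≤ j ∧ ∃ hj : j < q.length, A q[j] (p[0]'(by omega)) :=
    ⟨q.length - 1, by omega, by omega, hlast⟩
  obtain ⟨hjK, hj, hjA⟩ := Nat.find_spec hex
  have hmin := fun m hm => Nat.find_min hex (m := m) hm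
  generalize Nat.find hex = j at hjK hj hjA hmin
  have hsub : {x | x ∈ q.take (j + 1)} ⊆ S := fun x hx => hqS x (List.mem_of_mem_take hx)
  have htl : (q.take (j + 1)).length = j + 1 := by simp; omega
  -- In the truncated path only `q[j]` and the first `K - 2` vertices can lead to `p[0]`, so at most
  -- `K - 1` colours are blocked. The default 0 never occurs, as `K ≤ q.length`.
  let used : Finset ℕ :=
    insert (f q[j]) ((Finset.range (K - 2)).image fun i => if h : i < q.length then f q[i] else 0)
  have hcard : used.card < (Finset.range K).card := by
    refine (Finset.card_insert_le _ _).trans_lt ?_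
    have := (Finset.card_image_le (s := Finset.range (K - 2))
      (f := fun i => if h : i < q.length then f q[i] else 0))
    simp only [Finset.card_range] at *
    omega
  obtain ⟨c, hcK, hcu⟩ := Finset.exists_mem_notMem_of_card_lt_card hcard
  refine ⟨q.take (j + 1) ++ p, ⟨by simp [h.ne_nil], ?_, ?_, ?_⟩, ?_, ?_⟩
  · refine List.nodup_append.2 ⟨hq.sublist (List.take_sublist _ _), h.nodup, fun a ha b hb hab => ?_⟩
    subst hab
    exact h.notMem a hb (hsub ha)
  · refine List.isChain_append.2 ⟨hqch.take _, h.chain, fun x hx y hy => ?_⟩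
    rw [getLast?_take_succ hj] at hx
    rw [List.head?_eq_getElem?, List.getElem?_eq_getElem (by omega)] at hy
    cases hx
    cases hy
    exact hjA
  · intro x hx y hy
    rw [List.getLast?_append_of_ne_nil _ h.ne_nil, List.getLast?_eq_getElem?,
      List.getElem?_eq_getElem (by omega)] at hx
    rw [List.head?_append_of_ne_nil _ (List.ne_nil_of_length_pos (by omega)), List.head?_take,
      if_neg (by omega), List.head?_eq_getElem?, List.getElem?_eq_getElem (by omega)] at hy
    cases hx
    cases hy
    exact hfirst
  · rw [List.length_append, htl]
    omega
  · have := h.colorableOn_of_free hsub hlen₂ hlen (fun x hx => hf x (hsub hx))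
      (fun x hx y hy => hc x (hsub hx) y (hsub hy)) (Finset.mem_range.1 hcK) fun x hx hA hxc => by
        obtain ⟨t, ht, rfl⟩ := List.getElem_of_mem hx
        rw [htl] at ht
        have ht' : t < q.length := by omega
        rw [List.getElem_take] at hA hxc
        refine hcu ?_
        by_cases hle : K - 2 ≤ t
        · obtain rfl : t = j := by
            by_contra hne
            exact hmin t (by omega) ⟨hle, ht', hA⟩
          exact Finset.mem_insert.2 (.inl hxc.symm)
        · refine Finset.mem_insert_of_mem (Finset.mem_image.2 ⟨t, Finset.mem_range.2 (by omega), ?_⟩)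
          rw [dif_pos ht', hxc]
    refine this.mono fun x hx => ?_
    simpa using hx

/-- The good cycle when the ear is short: contract the ear to its first vertex. -/
theorem IsInducedEar.exists_good_of_short {S : Finset V} {p : List V}
    (h : IsInducedEar A (S : Set V) p) {K : ℕ} (hK : 2 ≤ K) (hstr : StrongOn A (S : Set V))
    (hS : ColorableOn A (S : Set V) K) (hlen₂ : 2 ≤ p.length) (hlen : p.length ≤ K)
    (hnc : ¬ ColorableOn A ((S : Set V) ∪ {x | x ∈ p}) (K + 1)) :
    ∃ c, IsCycle A c ∧ K + 1 ≤ c.length ∧ ColorableOn A {x | x ∈ c} (K + 1) := by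
  classical
  have h0 : 0 < p.length := by omega
  have h1 : p.length - 1 < p.length := by omega
  -- The contracted ear: `p[0]` keeps its incoming arcs from `S` and takes over the outgoing arcs of
  -- the last vertex of `p`.
  let B : V → V → Prop := fun x y => (x ≠ p[0] ∧ A x y) ∨ (x = p[0] ∧ A p[p.length - 1] y)
  have hp0 : p[0] ∉ S := h.notMem _ (List.getElem_mem _)
  have hBS : ∀ x ∈ S, ∀ y, B x y ↔ A x y := by
    intro x hx y
    have : x ≠ p[0] := by rintro rfl; exact hp0 hx
    simp [B, this]
  have hB0 : ∀ y, B p[0] y ↔ A p[p.length - 1] y := fun y => by simp [B]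
  have hsub : (S : Set V) ⊆ (insert p[0] S : Finset V) := by simp
  have hBstr : StrongOn B ((insert p[0] S : Finset V) : Set V) := by
    refine strongOn_of_subset (S := S) (fun x hx y hy => Relation.ReflTransGen.mono (fun a b hab =>
      ⟨(hBS a hab.2.1 b).2 hab.1, hsub hab.2.1, hsub hab.2.2⟩) _ _ (hstr x hx y hy)) fun x hx => ?_
    rcases Finset.mem_insert.1 hx with rfl | hx
    · obtain ⟨a, ha, hin⟩ := h.exists_entry
      obtain ⟨b, hb, hout⟩ := h.exists_exit
      refine ⟨⟨a, ha, .single ⟨(hBS a ha _).2 (hin _ ?_), hsub ha, by simp⟩⟩,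
        b, hb, .single ⟨(hB0 b).2 (hout _ ?_), by simp, hsub hb⟩⟩
      · simp [List.head?_eq_getElem?]
      · simp [List.getLast?_eq_getElem?]
    · exact ⟨⟨x, hx, .refl⟩, x, hx, .refl⟩
  have hBnc : ¬ ColorableOn B ((insert p[0] S : Finset V) : Set V) K := by
    rintro ⟨f, hf, hc⟩
    -- The colour of the contracted vertex would serve as a free colour for `p[0]`.
    refine hnc (h.colorableOn_of_free subset_rfl hlen₂ hlen (fun x hx => hf x (hsub hx))
      (fun x hx y hy hxy => hc x (hsub hx) y (hsub hy) ((hBS x hx y).2 hxy)) (hf p[0] (by simp))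
      fun x hx hxA => hc x (hsub hx) p[0] (by simp) ((hBS x hx _).2 hxA) ?_)
    rintro rfl
    exact hp0 hx
  obtain ⟨c, hcyc, hcS, hclen⟩ := exists_long_cycle (by omega) _ hBstr hBnc
  have himp : ∀ l : List V, (∀ x ∈ l, x ∈ S) → l.IsChain B → l.IsChain A := by
    intro l hl hch
    exact List.isChain_iff_getElem.2 fun i hi =>
      (hBS _ (hl _ (List.getElem_mem _)) _).1 (List.isChain_iff_getElem.1 hch i hi)
  by_cases hmem : p[0] ∈ c
  · obtain ⟨q, hq, hperm⟩ := hcyc.rotate hmem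
    have hnd := List.nodup_cons.1 hq.2.1
    have hqS : ∀ x ∈ q, x ∈ S := fun x hx => by
      rcases Finset.mem_insert.1 (hcS x (hperm.subset (List.mem_cons_of_mem _ hx))) with rfl | hx'
      · exact absurd hx hnd.1
      · exact hx'
    have hql := hperm.length_eq
    rw [List.length_cons] at hql
    have hch := List.isChain_cons.1 hq.2.2.1
    have hq0 : q ≠ [] := List.ne_nil_of_length_pos (by omega)
    refine h.exists_good_of_path hK hS hlen₂ hlen hnd.2 hqS (himp q hqS hch.2) (by omega)
      ((hB0 _).1 (hch.1 _ ?_)) ((hBS _ (hqS _ (List.getElem_mem _)) _).1 (hq.2.2.2 _ ?_ _ (by simp)))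
    · rw [List.head?_eq_getElem?, List.getElem?_eq_getElem (by omega)]
      rfl
    · rw [← List.singleton_append, List.getLast?_append_of_ne_nil _ hq0, List.getLast?_eq_getElem?,
        List.getElem?_eq_getElem (by omega)]
      rfl
  -- A cycle missing the contracted vertex lies in `S`, which is already `K`-colourable.
  · have hcS' : ∀ x ∈ c, x ∈ S := fun x hx => by
      rcases Finset.mem_insert.1 (hcS x hx) with rfl | hx'
      · exact absurd hx hmem
      · exact hx'
    exact ⟨c, ⟨hcyc.1, hcyc.2.1, himp c hcS' hcyc.2.2.1, fun x hx y hy =>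
      (hBS x (hcS' x (List.mem_of_getLast? hx)) y).1 (hcyc.2.2.2 x hx y hy)⟩, hclen,
      (hS.mono hcS').le (by omega)⟩

/-! ### The finite case -/

/-- A finite strong set that is not `K`-colourable contains a cycle of length more than `K` whose
vertex set is `K + 1`-colourable. -/
theorem exists_good_of_finite {T : Finset V} {K : ℕ} (hK : 2 ≤ K) (hT : StrongOn A (T : Set V))
    (hnc : ¬ ColorableOn A (T : Set V) K) :
    ∃ c, IsCycle A c ∧ K + 1 ≤ c.length ∧ ColorableOn A {x | x ∈ c} (K + 1) := by
  classical
  obtain ⟨r, hr⟩ : T.Nonempty := by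
    by_contra hne
    rw [Finset.not_nonempty_iff_eq_empty] at hne
    exact hnc ⟨fun _ => 0, by simp [hne]⟩
  let F : Finset (Finset V) := T.powerset.filter fun S => S.Nonempty ∧ StrongOn A (S : Set V) ∧
    ColorableOn A (S : Set V) K
  have hF : F.Nonempty := by
    refine ⟨{r}, Finset.mem_filter.2 ⟨by simpa using hr, by simp, ?_, fun _ => 0, ?_, ?_⟩⟩
    · intro x hx y hy
      obtain rfl : x = r := by simpa using hx
      obtain rfl : y = x := by simpa using hy
      exact .refl
    · intro x _
      change 0 < K
      omega
    · intro x hx y hy _ hne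
      obtain rfl : x = r := by simpa using hx
      obtain rfl : y = x := by simpa using hy
      exact absurd rfl hne
  obtain ⟨S, hSF, hmax⟩ := F.exists_max_image Finset.card hF
  obtain ⟨hST, hSne, hSstr, hSc⟩ := Finset.mem_filter.1 hSF
  rw [Finset.mem_powerset] at hST
  have hss : (S : Set V) ⊂ T := by
    refine ⟨Finset.coe_subset.2 hST, fun hTS => hnc (hSc.mono hTS)⟩
  obtain ⟨p, hp, hpT⟩ := exists_isInducedEar hT hss (by simpa using hSne)
  by_cases hch : ∃ i j, ∃ (hi : i < p.length) (hj : j < p.length), A p[j] p[i] ∧ i + K ≤ j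
  · exact hp.exists_good_of_chord hK hch
  push Not at hch
  have hU : ((S ∪ p.toFinset : Finset V) : Set V) = (S : Set V) ∪ {x | x ∈ p} := by
    ext; simp
  by_cases hcol : ColorableOn A ((S : Set V) ∪ {x | x ∈ p}) (K + 1)
  · have hUstr : StrongOn A ((S ∪ p.toFinset : Finset V) : Set V) := hU ▸ hp.strongOn hSstr
    have hUnc : ¬ ColorableOn A ((S ∪ p.toFinset : Finset V) : Set V) K := by
      intro hUc
      have hle := hmax (S ∪ p.toFinset) (Finset.mem_filter.2 ⟨Finset.mem_powerset.2
        (Finset.union_subset hST fun x hx => hpT x (by simpa using hx)),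
        hSne.mono Finset.subset_union_left, hUstr, hUc⟩)
      have heq := Finset.eq_of_subset_of_card_le Finset.subset_union_left hle
      obtain ⟨x, hx⟩ := List.exists_mem_of_ne_nil p hp.ne_nil
      refine hp.notMem x hx ?_
      rw [Finset.mem_coe, heq]
      simp [hx]
    obtain ⟨c, hc, hcU, hlen⟩ := exists_long_cycle (by omega) _ hUstr hUnc
    refine ⟨c, hc, hlen, hcol.mono fun x hx => ?_⟩
    rw [← hU]
    exact hcU x hx
  -- The ends of the ear are now adjacent: a forward arc forces length 2, a backward one length at
  -- most `K`.
  · have hadj : ¬ ∀ i (hi : i < p.length) (h0 : 0 < p.length), 0 < i → i + 1 = p.length →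
        ¬ A p[0] p[i] ∧ ¬ A p[i] p[0] := fun hna =>
      hcol (hp.colorableOn_of_not_adj hK hSc hch hna)
    push Not at hadj
    obtain ⟨i, hi, h0, hpos, hil, hor⟩ := hadj
    refine hp.exists_good_of_short hK hSstr hSc (by omega) ?_ hcol
    by_cases hA : A p[0] p[i]
    · have := hp.forward 0 i h0 hi hA
      omega
    · have := hch 0 i h0 hi (hor hA)
      omega

/-! ### Reduction to finite vertex sets -/

open Classical in
theorem exists_finset_of_reflTransGen {x y : V} (h : Relation.ReflTransGen A x y) :
    ∃ t : Finset V, x ∈ t ∧ y ∈ t ∧ ∀ z ∈ t, Relation.ReflTransGen (restrict A (t : Set V)) x z ∧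
      Relation.ReflTransGen (restrict A (t : Set V)) z y := by
  induction h using Relation.ReflTransGen.head_induction_on with
  | refl =>
    refine ⟨{y}, by simp, by simp, fun z hz => ?_⟩
    obtain rfl : z = y := by simpa using hz
    exact ⟨.refl, .refl⟩
  | @head a b hab _ ih =>
    obtain ⟨t, hb, hy, ht⟩ := ih
    have hmono := Relation.ReflTransGen.mono
      (restrict_mono (A := A) (show (t : Set V) ⊆ (insert a t : Finset V) by simp))
    have harc : restrict A ((insert a t : Finset V) : Set V) a b := ⟨hab, by simp, by simp [hb]⟩
    refine ⟨insert a t, by simp, by simp [hy], fun z hz => ?_⟩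
    rcases Finset.mem_insert.1 hz with rfl | hz
    · exact ⟨.refl, .head harc (hmono _ _ (ht b hb).2)⟩
    · exact ⟨.head harc (hmono _ _ (ht z hz).1), hmono _ _ (ht z hz).2⟩

/-- In a strong digraph every finite set of vertices lies in a finite strong one. -/
theorem exists_finset_strongOn (hA : ∀ x y, Relation.ReflTransGen A x y) (F : Finset V) :
    ∃ T : Finset V, F ⊆ T ∧ StrongOn A (T : Set V) := by
  classical
  choose t htx hty ht using fun x y => exists_finset_of_reflTransGen (hA x y)
  -- The vertices of one chosen walk for each ordered pair from `F`; each of them is reached from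
  -- `F` and leads back to it.
  let T := F.biUnion fun x => F.biUnion fun y => t x y
  have hsub : ∀ x ∈ F, ∀ y ∈ F, (t x y : Set V) ⊆ T := by
    intro x hx y hy z hz
    exact Finset.mem_biUnion.2 ⟨x, hx, Finset.mem_biUnion.2 ⟨y, hy, hz⟩⟩
  have hmono := fun x hx y hy =>
    Relation.ReflTransGen.mono (restrict_mono (A := A) (hsub x hx y hy))
  refine ⟨T, fun x hx => hsub x hx x hx (htx x x), strongOn_of_subset (S := (F : Set V))
    (fun x hx y hy => hmono x hx y hy _ _ (ht x y y (hty x y)).1) fun z hz => ?_⟩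
  obtain ⟨x, hx, hz⟩ := Finset.mem_biUnion.1 hz
  obtain ⟨y, hy, hz⟩ := Finset.mem_biUnion.1 hz
  exact ⟨⟨x, hx, hmono x hx y hy _ _ (ht x y z hz).1⟩, y, hy, hmono x hx y hy _ _ (ht x y z hz).2⟩

/-- The De Bruijn–Erdős theorem for colourings of relations. -/
theorem colorable_fromRel_of_finite {K : ℕ}
    (h : ∀ F : Finset V, ColorableOn A (F : Set V) K) : (SimpleGraph.fromRel A).Colorable K := by
  refine SimpleGraph.nonempty_hom_of_forall_finite_subgraph_hom fun G' hfin => Classical.choice ?_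
  obtain ⟨f, hf, hc⟩ := h hfin.toFinset
  rw [hfin.coe_toFinset] at hf hc
  refine ⟨⟨fun x => ⟨f x, hf x x.2⟩, fun {x y} hxy => ?_⟩⟩
  have hadj := G'.adj_sub hxy
  rw [SimpleGraph.fromRel_adj] at hadj
  have hne : f x ≠ f y := by
    rcases hadj.2 with h | h
    · exact hc x x.2 y y.2 h hadj.1
    · exact (hc y y.2 x x.2 h hadj.1.symm).symm
  simpa [Fin.ext_iff] using hne

end RelCircuit

/-! ### Translation to oriented multi-graphs -/

namespace OrientedMultigraph

variable {V : Type u} {E : Type v}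

theorem StronglyConnected.reflTransGen {D : OrientedMultigraph V E} (h : D.StronglyConnected)
    (x y : V) : Relation.ReflTransGen D.Arrow x y := by
  obtain ⟨p, ⟨hne, -, hch⟩, hx, hy⟩ := h x y
  have := List.relationReflTransGen_of_exists_isChain p hch hne
  rw [List.head?_eq_some_head hne, Option.some_inj] at hx
  rw [List.getLast?_eq_some_getLast hne, Option.some_inj] at hy
  rwa [hx, hy] at this

theorem arrow_of_induce {D : OrientedMultigraph V E} {S : Set V} {x y : S}
    (h : (D.induce S).Arrow x y) : D.Arrow x y := by
  obtain ⟨e, he⟩ := h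
  refine ⟨e.1, ?_⟩
  have h₁ := congrArg (fun z : S × S => (z.1 : V)) he
  have h₂ := congrArg (fun z : S × S => (z.2 : V)) he
  exact Prod.ext h₁ h₂

theorem chromaticNumber_induce_le {D : OrientedMultigraph V E} {S : Set V} {n : ℕ}
    (h : RelCircuit.ColorableOn D.Arrow S n) : (D.induce S).chromaticNumber ≤ n := by
  obtain ⟨f, hf, hc⟩ := h
  refine SimpleGraph.chromaticNumber_le_iff_colorable.2
    ⟨SimpleGraph.Coloring.mk (fun x => ⟨f x, hf x x.2⟩) fun {x y} hxy heq => ?_⟩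
  have heq' : f x = f y := congrArg Fin.val heq
  have hne : (x : V) ≠ y := fun h => hxy.1 (Subtype.ext h)
  rcases hxy.2 with h | h
  · exact hc x x.2 y y.2 (arrow_of_induce h) hne heq'
  · exact hc y y.2 x x.2 (arrow_of_induce h) hne.symm heq'.symm

end OrientedMultigraph

theorem lemma3p4 {V : Type u} {E : Type v} (D : OrientedMultigraph V E)
    (hD : D.StronglyConnected) (k : ℕ) (hk : 3 ≤ k) (hkD : (k : ℕ∞) ≤ D.chromaticNumber) :
    ∃ c : List V, D.IsGoodCircuit k c := by
  obtain ⟨K, rfl⟩ : ∃ K, k = K + 1 := ⟨k - 1, by omega⟩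
  obtain ⟨F, hF⟩ : ∃ F : Finset V, ¬ RelCircuit.ColorableOn D.Arrow (F : Set V) K := by
    by_contra! hcon
    have hle : D.chromaticNumber ≤ K :=
      SimpleGraph.chromaticNumber_le_iff_colorable.2 (RelCircuit.colorable_fromRel_of_finite hcon)
    have := Nat.cast_le.1 (hkD.trans hle)
    omega
  obtain ⟨T, hFT, hT⟩ := RelCircuit.exists_finset_strongOn hD.reflTransGen F
  obtain ⟨c, hc, hlen, hcol⟩ := RelCircuit.exists_good_of_finite (by omega) hT
    fun h => hF (h.mono (Finset.coe_subset.2 hFT))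
  refine ⟨c, ⟨hc.2.1, hc.2.2.1, c.head hc.1, c.getLast hc.1, List.head?_eq_some_head hc.1,
    List.getLast?_eq_some_getLast hc.1, hc.2.2.2 _ (List.getLast?_eq_some_getLast hc.1) _
      (List.head?_eq_some_head hc.1)⟩, hlen, D.chromaticNumber_induce_le hcol⟩
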